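/- Let $X_1,\dots,X_d\in M_n(\mathbb C)$ and $T=\sum_{i}\overline{X_i}\otimes X_i\in M_{n^2}(\mathbb C)$ (Kronecker product, entrywise complex conjugate). Assume that the outer spectral radius $\hat\rho(X_1,\dots,X_d)=\sqrt{\rho(T)}$ equals $1$, where $\rho$ is the spectral radius, and that $X_1,\dots,X_d$ generate the full algebra $M_n(\mathbb C)$. Let $\operatorname{vec}:M_n(\mathbb C)\to\mathbb C^{n^2}$ be the column-stacking vectorization. Let $\eta$ be the largest size of a Jordan block of $T$ belonging to an eigenvalue of maximum modulus. For a sequence $c=(c_k)_{k\ge1}$ of nonzero reals put $$\hat T_c=\lim_{N\to\infty}\frac1N\sum_{k=1}^N\frac{T^k}{c_k}$$ whenever the limit exists. (1) For $c_k=k^{\eta-1}$ the limit $\hat T_c$ exists and there are positive definite $V,W\in M_n(\mathbb C)$ with $\hat T_c=\operatorname{vec}V\,(\operatorname{vec}W)^*$. (2) For $c_k=\|T^k\|$, with any norm $\|\cdot\|$ on $M_{n^2}(\mathbb C)$, the same holds if $1$ is the only eigenvalue of $T$ of modulus one, or if $\|T^k\|$ converges as $k\to\infty$. (3) Let $c_k=k^{\eta-1}$,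 or $c_k=\|T^k\|$ with any norm on $M_{n^2}(\mathbb C)$. If the limit $\hat T_c$ exists and $\hat T_c=\operatorname{vec}V\,(\operatorname{vec}W)^*$ for some $V,W\in M_n(\mathbb C)$, then $V$ and $W$ are positive definite up to a common phase: there is $z\in\mathbb C$, $|z|=1$, with $zV>0$ and $zW>0$. If moreover $V$ and $W$ are positive definite, then $$\acute X=(V^{-1/2}X_1V^{1/2},\dots,V^{-1/2}X_dV^{1/2})$$ is a row co-isometry, i.e. $R=[\acute X_1\ \cdots\ \acute X_d]$ satisfies $RR^*=I$, and $$\grave X=(W^{1/2}X_1W^{-1/2},\dots,W^{1/2}X_dW^{-1/2})$$ is a column isometry, i.e. the block column $C$ with blocks $\grave X_1,\dots,\grave X_d$ satisfies $C^*C=I$. Moreover, the map $H\mapsto\sum_i\acute X_iH\acute X_i^*$ is unital (it sends $I$ to $I$), and $H\mapsto\sum_i\grave X_iH\grave X_i^*$ is trace preserving. -/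

import Mathlib

open Filter Topology
open scoped Matrix Kronecker ComplexOrder MatrixOrder ENNReal

noncomputable section

namespace OuterSpectrum

/-- The matrix `T = ∑ conj(Xᵢ) ⊗ Xᵢ` of a tuple of matrices. -/
def transferMatrix {n d : ℕ} (X : Fin d → Matrix (Fin n) (Fin n) ℂ) :
    Matrix (Fin n × Fin n) (Fin n × Fin n) ℂ :=
  ∑ i, (X i).map (starRingEnd ℂ) ⊗ₖ X i

/-- The outer spectral radius, the square root of the spectral radius of `∑ conj(Xᵢ) ⊗ Xᵢ`. -/
def outerSpectralRadius {n d : ℕ} (X : Fin d → Matrix (Fin n) (Fin n) ℂ) : ℝ :=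
  Real.sqrt (spectralRadius ℂ (transferMatrix X)).toReal

/-- The completely positive map `φ(H) = ∑ Xᵢ H Xᵢ*`. -/
def krausMap {n d : ℕ} (X : Fin d → Matrix (Fin n) (Fin n) ℂ)
    (H : Matrix (Fin n) (Fin n) ℂ) : Matrix (Fin n) (Fin n) ℂ :=
  ∑ i, X i * H * (X i)ᴴ

/-- The map sends the identity to the identity. -/
def IsUnital {n : ℕ} (φ : Matrix (Fin n) (Fin n) ℂ → Matrix (Fin n) (Fin n) ℂ) : Prop :=
  φ 1 = 1

/-- The map preserves the trace. -/
def IsTracePreserving {n : ℕ}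
    (φ : Matrix (Fin n) (Fin n) ℂ → Matrix (Fin n) (Fin n) ℂ) : Prop :=
  ∀ H, (φ H).trace = H.trace

/-- The block row `[X₁ ⋯ X_d]`. -/
def blockRow {n d : ℕ} (X : Fin d → Matrix (Fin n) (Fin n) ℂ) :
    Matrix (Fin n) (Fin d × Fin n) ℂ :=
  Matrix.of fun a p => X p.1 a p.2

/-- The block column with blocks `X₁, …, X_d`. -/
def blockCol {n d : ℕ} (X : Fin d → Matrix (Fin n) (Fin n) ℂ) :
    Matrix (Fin d × Fin n) (Fin n) ℂ :=
  Matrix.of fun p b => X p.1 p.2 b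

/-- The block row `R` is a co-isometry: `R R* = 1`. -/
def IsRowCoisometry {n d : ℕ} (X : Fin d → Matrix (Fin n) (Fin n) ℂ) : Prop :=
  blockRow X * (blockRow X)ᴴ = 1

/-- The block column `C` is an isometry: `C* C = 1`. -/
def IsColumnIsometry {n d : ℕ} (X : Fin d → Matrix (Fin n) (Fin n) ℂ) : Prop :=
  (blockCol X)ᴴ * blockCol X = 1

/-- `(V^{-1/2} Xᵢ V^{1/2})ᵢ`. -/
def rowConj {n d : ℕ} (V : Matrix (Fin n) (Fin n) ℂ)
    (X : Fin d → Matrix (Fin n) (Fin n) ℂ) : Fin d → Matrix (Fin n) (Fin n) ℂ :=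
  fun i => (CFC.sqrt V)⁻¹ * X i * CFC.sqrt V

/-- `(W^{1/2} Xᵢ W^{-1/2})ᵢ`. -/
def colConj {n d : ℕ} (W : Matrix (Fin n) (Fin n) ℂ)
    (X : Fin d → Matrix (Fin n) (Fin n) ℂ) : Fin d → Matrix (Fin n) (Fin n) ℂ :=
  fun i => CFC.sqrt W * X i * (CFC.sqrt W)⁻¹

/-- The rank one matrix `vec V (vec W)*`, where `vec` stacks columns. -/
def vecOuter {n : ℕ} (V W : Matrix (Fin n) (Fin n) ℂ) :
    Matrix (Fin n × Fin n) (Fin n × Fin n) ℂ :=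
  Matrix.vecMulVec V.vec (star W.vec)

/-- The maximal degeneracy index of `T`: the largest size of a Jordan block of `T` that belongs
to an eigenvalue of maximum modulus. The index at which the generalized eigenspaces of `μ`
stabilize is the largest size of a Jordan block for `μ`. -/
def maxDegeneracyIndex {ι : Type*} [Fintype ι] [DecidableEq ι] (T : Matrix ι ι ℂ) : ℕ :=
  sSup {m | ∃ μ : ℂ, Module.End.HasEigenvalue (Matrix.toLin' T) μ ∧
    (‖μ‖₊ : ℝ≥0∞) = spectralRadius ℂ T ∧
      m = Module.End.maxGenEigenspaceIndex (Matrix.toLin' T) μ}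

/-- `S = lim_N (1/N) ∑_{k=1}^N T^k / c_k`. -/
def IsAverageLimit {ι : Type*} [Fintype ι] [DecidableEq ι] (T : Matrix ι ι ℂ) (c : ℕ → ℝ)
    (S : Matrix ι ι ℂ) : Prop :=
  Tendsto (fun N : ℕ => (N : ℝ)⁻¹ • ∑ k ∈ Finset.Icc 1 N, (c k)⁻¹ • T ^ k) atTop (𝓝 S)

/-- The intrinsic normalization: for a matrix of spectral radius one, `‖T ^ k‖` is comparable
to `k ^ (η - 1)`, where `η` is the maximal degeneracy index (which is at least one whenever
there are eigenvalues at all). -/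
def growth {ι : Type*} [Fintype ι] [DecidableEq ι] (T : Matrix ι ι ℂ) (k : ℕ) : ℝ :=
  (k : ℝ) ^ (maxDegeneracyIndex T - 1)

/-- The normalization by a norm on the space of matrices. -/
def IsNormGrowth {ι : Type*} [Fintype ι] [DecidableEq ι] (T : Matrix ι ι ℂ)
    (c : ℕ → ℝ) : Prop :=
  ∃ p : Seminorm ℂ (Matrix ι ι ℂ), (∀ A, p A = 0 → A = 0) ∧ ∀ k, c k = p (T ^ k)

end OuterSpectrum

end

/-! Under `vec`, `T` is the completely positive map `φ(H) = ∑ Xᵢ H Xᵢ*`, and its action on row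
vectors `(vec H)*` is the adjoint map. Since the `Xᵢ` generate the full matrix algebra, `φ` is
irreducible, so Perron–Frobenius (`exists_posDef_eigenvector`) gives positive definite eigenvectors
`V` of `φ` and `W` of its adjoint; the trace pairing forces their eigenvalues to agree, say to `t`.

The key tool is the Hilbert norm `‖W^{1/2} Z V^{-1/2}‖`. Expanding squares (`sum_weightedNorm_sq`)
shows that `t‖Z‖² + (t - 2)‖φ(Z)‖²` is a sum of squares. For an eigenvector with `|μ| = 1` this
gives `t ≥ 1`, and spectral radius one gives `t ≤ 1`. With `t = 1`, `φ` is a contraction, so the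
powers of `T` are bounded and `η = 1`. Equality for a fixed point `Z` makes `Z V⁻¹` commute with
every `Xᵢ`, so `Z` is a multiple of `V`.

The mean ergodic theorem then identifies the plain average as `vec V (vec W)*`, once `tr(WV) = 1`. A
norm normalization stays between positive constants, and a convergent one only rescales this limit.
In general any limit acts on `vec V` and `(vec W)*` by one positive scalar; if it has rank one, its
factors are therefore multiples of `V` and `W`, hence fixed points. Conjugating the fixed point
equations by square roots gives the isometry statements. -/

namespace OuterSpectrum

/-! ### Mean ergodic theorem and peripheral spectrum of power-bounded matrices -/

section Averages

open scoped Matrix.Norms.Operator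

variable {ι : Type*} [Fintype ι] [DecidableEq ι]

/-- A matrix whose powers are bounded, with a one-dimensional space of fixed vectors spanned by
`v`, and a fixed row vector `w` normalized by `w ⬝ᵥ v = 1`. -/
structure IsErgodic (T : Matrix ι ι ℂ) (v w : ι → ℂ) : Prop where
  bounded : ∃ C : ℝ, ∀ k : ℕ, ‖T ^ k‖ ≤ C
  mulVec_eq : T *ᵥ v = v
  vecMul_eq : w ᵥ* T = w
  dotProduct_eq : w ⬝ᵥ v = 1
  fixed : ∀ u, T *ᵥ u = u → ∃ c : ℂ, u = c • v

namespace IsErgodic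

variable {T : Matrix ι ι ℂ} {v w : ι → ℂ}

lemma proj_mul (h : IsErgodic T v w) : Matrix.vecMulVec v w * T = Matrix.vecMulVec v w := by
  rw [Matrix.vecMulVec_mul, h.vecMul_eq]

lemma proj_mul_proj (h : IsErgodic T v w) :
    Matrix.vecMulVec v w * Matrix.vecMulVec v w = Matrix.vecMulVec v w := by
  rw [Matrix.vecMulVec_mul_vecMulVec, h.dotProduct_eq]; simp

lemma pow_mulVec (h : IsErgodic T v w) (k : ℕ) : (T ^ k) *ᵥ v = v := by
  induction k with
  | zero => simp
  | succ k ih => rw [pow_succ, ← Matrix.mulVec_mulVec, h.mulVec_eq, ih]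

lemma vecMul_pow (h : IsErgodic T v w) (k : ℕ) : w ᵥ* (T ^ k) = w := by
  induction k with
  | zero => simp
  | succ k ih => rw [pow_succ, ← Matrix.vecMul_vecMul, ih, h.vecMul_eq]

lemma ne_zero (h : IsErgodic T v w) : v ≠ 0 := by
  rintro rfl
  simpa using h.dotProduct_eq

/-- Pairing a kernel vector `u` with `w` gives `w ⬝ᵥ u = 0`, so `u` is fixed by `T`, hence a
multiple of `v`, and the pairing kills it. -/
lemma isUnit_one_sub_add (h : IsErgodic T v w) : IsUnit (1 - T + Matrix.vecMulVec v w) := by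
  rw [← Matrix.mulVec_injective_iff_isUnit, ← Matrix.coe_mulVecLin, ← LinearMap.ker_eq_bot,
    LinearMap.ker_eq_bot']
  intro u hu
  rw [Matrix.mulVecLin_apply, Matrix.add_mulVec, Matrix.sub_mulVec, Matrix.one_mulVec,
    Matrix.vecMulVec_mulVec] at hu
  have hw : w ⬝ᵥ u = 0 := by
    have := congrArg (w ⬝ᵥ ·) hu
    simpa [dotProduct_add, dotProduct_sub, Matrix.dotProduct_mulVec, h.vecMul_eq,
      h.dotProduct_eq] using this
  have hT : T *ᵥ u = u := by
    rw [hw] at hu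
    simp only [MulOpposite.op_zero, zero_smul, add_zero] at hu
    exact (sub_eq_zero.mp hu).symm
  obtain ⟨c, rfl⟩ := h.fixed u hT
  rw [dotProduct_smul, h.dotProduct_eq, smul_eq_mul, mul_one] at hw
  simp [hw]

/-- The mean ergodic theorem for an ergodic matrix. -/
lemma isAverageLimit_one (h : IsErgodic T v w) :
    IsAverageLimit T (fun _ => 1) (Matrix.vecMulVec v w) := by
  obtain ⟨C, hC⟩ := h.bounded
  obtain ⟨A, hA⟩ := h.isUnit_one_sub_add
  set S := Matrix.vecMulVec v w with hS
  -- Inverting `A = 1 - T + S` writes `1 - S` as `(1 - T) A⁻¹`, so that the sum of `T ^ k - S = T ^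
  -- k (1 - S)` telescopes.
  have hSA : (1 - S) * A = 1 - T := by
    rw [hA]
    have h1 : S * T = S := h.proj_mul
    have h2 : S * S = S := h.proj_mul_proj
    simp only [sub_mul, mul_add, mul_sub, one_mul, mul_one, h1, h2]
    abel
  have hSA' : 1 - S = (1 - T) * (↑A⁻¹ : Matrix ι ι ℂ) := by
    rw [← hSA, mul_assoc, Units.mul_inv, mul_one]
  have hpow : ∀ k, T ^ k * S = S := fun k => by
    rw [hS, Matrix.mul_vecMulVec, h.pow_mulVec]
  have hsum : ∀ N : ℕ, ∑ k ∈ Finset.Icc 1 N, T ^ k * (1 - T) = T - T ^ (N + 1) := by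
    intro N
    induction N with
    | zero => simp
    | succ N ih =>
      rw [Finset.sum_Icc_succ_top (by omega), ih, mul_sub, mul_one, ← pow_succ]
      abel
  have key : ∀ N : ℕ, 1 ≤ N → (N : ℝ)⁻¹ • ∑ k ∈ Finset.Icc 1 N, (1 : ℝ)⁻¹ • T ^ k =
      S + (N : ℝ)⁻¹ • ((T - T ^ (N + 1)) * (↑A⁻¹ : Matrix ι ι ℂ)) := by
    intro N hN
    have hN' : (N : ℝ) ≠ 0 := by positivity
    rw [← hsum, Finset.sum_mul]
    have e : ∀ k, T ^ k * (1 - T) * (↑A⁻¹ : Matrix ι ι ℂ) = T ^ k - S := fun k => by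
      rw [mul_assoc, ← hSA', mul_sub, mul_one, hpow]
    simp only [e, inv_one, one_smul,
      Finset.sum_sub_distrib, Finset.sum_const, Nat.card_Icc, Nat.add_sub_cancel, smul_sub]
    rw [← Nat.cast_smul_eq_nsmul ℝ, smul_smul, inv_mul_cancel₀ hN', one_smul]
    abel
  rw [IsAverageLimit]
  have hlim : Tendsto (fun N : ℕ => S + (N : ℝ)⁻¹ • ((T - T ^ (N + 1)) *
      (↑A⁻¹ : Matrix ι ι ℂ))) atTop (𝓝 (S + 0)) := by
    refine tendsto_const_nhds.add ?_
    refine squeeze_zero_norm (a := fun N : ℕ => (N : ℝ)⁻¹ * ((C + C) *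
      ‖(↑A⁻¹ : Matrix ι ι ℂ)‖)) (fun N => ?_) ?_
    · rw [norm_smul, norm_inv, Real.norm_natCast]
      gcongr
      refine (norm_mul_le _ _).trans ?_
      gcongr
      refine (norm_sub_le _ _).trans (add_le_add ?_ (hC _))
      simpa using hC 1
    · simpa using tendsto_inv_atTop_nhds_zero_nat.mul_const ((C + C) * ‖(↑A⁻¹ : Matrix ι ι ℂ)‖)
  rw [add_zero] at hlim
  refine hlim.congr' ?_
  filter_upwards [eventually_ge_atTop 1] with N hN
  exact (key N hN).symm

end IsErgodic

/-- The powers of a matrix of spectral radius less than one tend to zero. -/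
lemma tendsto_pow_of_spectralRadius_lt_one {A : Type*} [NormedRing A] [NormedAlgebra ℂ A]
    [CompleteSpace A] {a : A} (ha : spectralRadius ℂ a < 1) :
    Tendsto (fun k : ℕ => a ^ k) atTop (𝓝 0) := by
  obtain ⟨r, hr, hr1⟩ := exists_between ha
  have hev := (spectrum.pow_nnnorm_pow_one_div_tendsto_nhds_spectralRadius a).eventually_lt_const hr
  have hr0 : Tendsto (fun k : ℕ => r ^ k) atTop (𝓝 0) :=
    ENNReal.tendsto_pow_atTop_nhds_zero_of_lt_one hr1
  rw [tendsto_iff_enorm_sub_tendsto_zero]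
  simp only [sub_zero]
  refine tendsto_of_tendsto_of_tendsto_of_le_of_le' tendsto_const_nhds hr0
    (Eventually.of_forall fun _ => zero_le) ?_
  filter_upwards [hev, eventually_ge_atTop 1] with k hk hk1
  have hk0 : (0 : ℝ) < k := by exact_mod_cast hk1
  have := ENNReal.rpow_le_rpow hk.le hk0.le
  rw [← ENNReal.rpow_mul, one_div, inv_mul_cancel₀ hk0.ne', ENNReal.rpow_one,
    ENNReal.rpow_natCast] at this
  exact this

lemma mem_spectrum_iff_exists_mulVec {A : Matrix ι ι ℂ} {μ : ℂ} :
    μ ∈ spectrum ℂ A ↔ ∃ u, u ≠ 0 ∧ A *ᵥ u = μ • u := by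
  rw [← Matrix.spectrum_toLin', ← Module.End.hasEigenvalue_iff_mem_spectrum]
  constructor
  · intro h
    obtain ⟨u, hu⟩ := h.exists_hasEigenvector
    exact ⟨u, hu.2, by simpa using hu.apply_eq_smul⟩
  · rintro ⟨u, hu, h⟩
    exact Module.End.hasEigenvalue_of_hasEigenvector
      ⟨Module.End.mem_eigenspace_iff.mpr (by simpa using h), hu⟩

lemma pow_mulVec_of_mulVec_eq_smul {A : Matrix ι ι ℂ} {μ : ℂ} {u : ι → ℂ}
    (h : A *ᵥ u = μ • u) (k : ℕ) : (A ^ k) *ᵥ u = μ ^ k • u := by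
  induction k with
  | zero => simp
  | succ k ih => rw [pow_succ, ← Matrix.mulVec_mulVec, h, Matrix.mulVec_smul, ih, smul_smul,
      pow_succ']

lemma norm_le_one_of_bounded_pow {A : Matrix ι ι ℂ} (hA : ∃ C : ℝ, ∀ k : ℕ, ‖A ^ k‖ ≤ C)
    {μ : ℂ} {u : ι → ℂ} (hu : u ≠ 0) (h : A *ᵥ u = μ • u) : ‖μ‖ ≤ 1 := by
  obtain ⟨C, hC⟩ := hA
  by_contra! hμ
  obtain ⟨k, hk⟩ := pow_unbounded_of_one_lt C hμ
  have h1 := Matrix.linfty_opNorm_mulVec (A ^ k) u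
  rw [pow_mulVec_of_mulVec_eq_smul h, norm_smul, norm_pow] at h1
  exact absurd (hk.trans_le ((le_of_mul_le_mul_right h1 (norm_pos_iff.mpr hu)).trans (hC k)))
    (lt_irrefl _)

/-- For a matrix with bounded powers, generalized eigenvectors of rank two to an eigenvalue of
modulus one are eigenvectors. -/
lemma mulVec_eq_smul_of_bounded_pow {A : Matrix ι ι ℂ} (hA : ∃ C : ℝ, ∀ k : ℕ, ‖A ^ k‖ ≤ C)
    {μ : ℂ} (hμ : ‖μ‖ = 1) {u y : ι → ℂ} (hu : A *ᵥ u = μ • u + y) (hy : A *ᵥ y = μ • y) :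
    y = 0 := by
  obtain ⟨C, hC⟩ := hA
  -- A Jordan chain of length two makes the powers grow linearly.
  have hpow : ∀ k : ℕ, (A ^ (k + 1)) *ᵥ u = μ ^ (k + 1) • u + ((k + 1 : ℂ) * μ ^ k) • y := by
    intro k
    induction k with
    | zero => simp [hu]
    | succ k ih =>
      rw [pow_succ', ← Matrix.mulVec_mulVec, ih, Matrix.mulVec_add, Matrix.mulVec_smul,
        Matrix.mulVec_smul, hu, hy]
      push_cast
      module
  by_contra hy0
  have hbd : ∀ k : ℕ, (k + 1) * ‖y‖ ≤ C * ‖u‖ + ‖u‖ := by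
    intro k
    have h1 := Matrix.linfty_opNorm_mulVec (A ^ (k + 1)) u
    have h2 : ((k + 1 : ℂ) * μ ^ k) • y = (A ^ (k + 1)) *ᵥ u - μ ^ (k + 1) • u := by
      rw [hpow]; abel
    have h3 := congrArg norm h2
    rw [norm_smul, norm_mul, norm_pow, hμ, one_pow, mul_one] at h3
    have h4 : ‖(k + 1 : ℂ)‖ = k + 1 := by exact_mod_cast Complex.norm_natCast (k + 1)
    rw [h4] at h3
    rw [h3]
    refine (norm_sub_le _ _).trans (add_le_add (h1.trans ?_) ?_)
    · gcongr; exact hC _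
    · rw [norm_smul, norm_pow, hμ, one_pow, one_mul]
  obtain ⟨k, hk⟩ := exists_nat_gt ((C * ‖u‖ + ‖u‖) / ‖y‖)
  rw [div_lt_iff₀ (norm_pos_iff.mpr hy0)] at hk
  have := hbd k
  have := norm_nonneg y
  linarith

/-- The peripheral eigenvalues of a matrix with bounded powers are semisimple. -/
lemma maxDegeneracyIndex_le_one {A : Matrix ι ι ℂ} (hA : ∃ C : ℝ, ∀ k : ℕ, ‖A ^ k‖ ≤ C)
    (hρ : spectralRadius ℂ A = 1) : maxDegeneracyIndex A ≤ 1 := by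
  refine csSup_le' ?_
  rintro m ⟨μ, -, hμ, rfl⟩
  have hμ1 : ‖μ‖ = 1 := by
    rw [hρ] at hμ
    have : ‖μ‖₊ = 1 := by exact_mod_cast hμ
    exact congrArg NNReal.toReal this
  set f := Matrix.toLin' A - algebraMap ℂ (Module.End ℂ (ι → ℂ)) μ with hf
  have hfu : ∀ u, f u = A *ᵥ u - μ • u := fun u => by simp [hf]
  have hker : LinearMap.ker (f ^ 1) = LinearMap.ker (f ^ 2) := by
    apply le_antisymm
    · intro u hu
      rw [LinearMap.mem_ker, pow_one] at hu
      rw [LinearMap.mem_ker, pow_two, Module.End.mul_apply, hu, map_zero]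
    · intro u hu
      rw [LinearMap.mem_ker, pow_two, Module.End.mul_apply] at hu
      rw [LinearMap.mem_ker, pow_one]
      refine mulVec_eq_smul_of_bounded_pow (u := u) hA hμ1 ?_ ?_
      · rw [hfu]; abel
      · rw [hfu (f u)] at hu
        exact sub_eq_zero.mp hu
  have hf' : f = Matrix.toLin' A - μ • (1 : Module.End ℂ (ι → ℂ)) := by
    rw [hf, Algebra.algebraMap_eq_smul_one]
  refine Nat.sInf_le fun n hn => ?_
  change Module.End.genEigenspace (Matrix.toLin' A) μ (1 : ℕ) =
    Module.End.genEigenspace (Matrix.toLin' A) μ (n : ℕ)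
  rw [Module.End.genEigenspace_nat, Module.End.genEigenspace_nat, ← hf']
  obtain ⟨m, rfl⟩ := Nat.exists_eq_add_of_le hn
  exact Module.End.ker_pow_constant hker m

/-- Subtracting the projection `S` removes the eigenvalue `1`, the only one of modulus one, so the
powers of `T - S` tend to zero. -/
lemma IsErgodic.tendsto_pow {T : Matrix ι ι ℂ} {v w : ι → ℂ} (h : IsErgodic T v w)
    (hμ : ∀ μ ∈ spectrum ℂ T, ‖μ‖ = 1 → μ = 1) :
    Tendsto (fun k : ℕ => T ^ k) atTop (𝓝 (Matrix.vecMulVec v w)) := by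
  set S := Matrix.vecMulVec v w with hS
  have hne : Nonempty ι := by
    by_contra hι
    rw [not_nonempty_iff] at hι
    exact h.ne_zero (Subsingleton.elim _ _)
  -- The exponent starts at one: at zero the two sides are `1` and `1 - S`.
  have hpow : ∀ k : ℕ, (T - S) ^ (k + 1) = T ^ (k + 1) - S := by
    intro k
    induction k with
    | zero => simp
    | succ k ih =>
      rw [pow_succ, ih, pow_succ T (k + 1)]
      simp only [sub_mul, mul_sub, hS, h.proj_mul, h.proj_mul_proj]
      rw [Matrix.mul_vecMulVec, h.pow_mulVec]
      abel
  have hsr : spectralRadius ℂ (T - S) < 1 := by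
    refine spectrum.spectralRadius_lt_of_forall_lt (r := 1) _ fun μ hmem => ?_
    obtain ⟨u, hu, hTu⟩ := mem_spectrum_iff_exists_mulVec.mp hmem
    by_contra! hge
    have hge' : 1 ≤ ‖μ‖ := hge
    -- Since `S (T - S) = 0` and `μ ≠ 0`, the eigenvector `u` lies in the kernel of `S` and is an
    -- eigenvector of `T`.
    have hSu : S *ᵥ u = 0 := by
      have h1 := congrArg (S *ᵥ ·) hTu
      simp only [Matrix.mulVec_mulVec, mul_sub, Matrix.mulVec_smul] at h1
      rw [hS, h.proj_mul, h.proj_mul_proj, sub_self, Matrix.zero_mulVec] at h1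
      refine (smul_eq_zero.mp h1.symm).resolve_left ?_
      rintro rfl
      simp at hge'
      linarith
    rw [Matrix.sub_mulVec, hSu, sub_zero] at hTu
    have h1 : μ = 1 := hμ μ (mem_spectrum_iff_exists_mulVec.mpr ⟨u, hu, hTu⟩)
      (le_antisymm (norm_le_one_of_bounded_pow h.bounded hu hTu) hge')
    rw [h1, one_smul] at hTu
    obtain ⟨c, rfl⟩ := h.fixed u hTu
    rw [hS, Matrix.mulVec_smul, Matrix.vecMulVec_mulVec, h.dotProduct_eq] at hSu
    simp only [MulOpposite.op_one, one_smul] at hSu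
    exact hu hSu
  have h0 := (tendsto_pow_of_spectralRadius_lt_one hsr).comp (tendsto_add_atTop_nat 1)
  have h1 : Tendsto (fun k : ℕ => (T - S) ^ (k + 1) + S) atTop (𝓝 (0 + S)) :=
    h0.add_const S
  simp only [hpow, sub_add_cancel, zero_add] at h1
  exact (tendsto_add_atTop_iff_nat (f := fun k => T ^ k) 1).mp h1

end Averages

/-! ### Irreducible completely positive maps -/

section PerronFrobenius

variable {n d : ℕ} {X : Fin d → Matrix (Fin n) (Fin n) ℂ}

lemma krausMap_add (A B : Matrix (Fin n) (Fin n) ℂ) :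
    krausMap X (A + B) = krausMap X A + krausMap X B := by
  simp [krausMap, mul_add, add_mul, Finset.sum_add_distrib]

lemma krausMap_sub (A B : Matrix (Fin n) (Fin n) ℂ) :
    krausMap X (A - B) = krausMap X A - krausMap X B := by
  simp [krausMap, mul_sub, sub_mul, Finset.sum_sub_distrib]

lemma krausMap_smul {R : Type*} [Monoid R] [DistribMulAction R ℂ] [IsScalarTower R ℂ ℂ]
    [SMulCommClass R ℂ ℂ] (c : R) (A : Matrix (Fin n) (Fin n) ℂ) :
    krausMap X (c • A) = c • krausMap X A := by
  simp [krausMap, Finset.smul_sum]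

lemma krausMap_conjTranspose (A : Matrix (Fin n) (Fin n) ℂ) :
    krausMap X Aᴴ = (krausMap X A)ᴴ := by
  simp [krausMap, Matrix.conjTranspose_sum, mul_assoc]

lemma continuous_krausMap : Continuous (krausMap X) := by
  unfold krausMap
  fun_prop

lemma posSemidef_krausMap {A : Matrix (Fin n) (Fin n) ℂ} (hA : A.PosSemidef) :
    (krausMap X A).PosSemidef :=
  Matrix.posSemidef_sum _ fun i _ => hA.mul_mul_conjTranspose_same (X i)

lemma trace_mul_krausMap (A B : Matrix (Fin n) (Fin n) ℂ) :
    (A * krausMap X B).trace = (krausMap (fun i => (X i)ᴴ) A * B).trace := by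
  simp only [krausMap, Finset.mul_sum, Finset.sum_mul, Matrix.trace_sum,
    Matrix.conjTranspose_conjTranspose]
  refine Finset.sum_congr rfl fun i _ => ?_
  rw [← mul_assoc, Matrix.trace_mul_comm]
  simp only [mul_assoc]

lemma transferMatrix_mulVec_vec (H : Matrix (Fin n) (Fin n) ℂ) :
    transferMatrix X *ᵥ H.vec = (krausMap X H).vec := by
  simp only [transferMatrix, krausMap, Matrix.sum_mulVec, Matrix.vec_sum,
    Matrix.kronecker_mulVec_vec]
  rfl

lemma star_vec_vecMul_transferMatrix (H : Matrix (Fin n) (Fin n) ℂ) :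
    star H.vec ᵥ* transferMatrix X = star (krausMap (fun i => (X i)ᴴ) H).vec := by
  rw [← star_star (star H.vec ᵥ* transferMatrix X), Matrix.star_vecMul, star_star]
  congr 1
  have : (transferMatrix X)ᴴ = transferMatrix fun i => (X i)ᴴ := by
    simp only [transferMatrix, Matrix.conjTranspose_sum, Matrix.conjTranspose_kronecker]
    rfl
  rw [this, transferMatrix_mulVec_vec]

lemma adjoin_range_conjTranspose (hgen : Algebra.adjoin ℂ (Set.range X) = ⊤) :
    Algebra.adjoin ℂ (Set.range fun i => (X i)ᴴ) = ⊤ := by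
  rw [eq_top_iff]
  rintro A -
  have key : ∀ B ∈ Algebra.adjoin ℂ (Set.range X),
      Bᴴ ∈ Algebra.adjoin ℂ (Set.range fun i => (X i)ᴴ) := by
    intro B hB
    induction hB using Algebra.adjoin_induction with
    | mem x hx =>
      obtain ⟨i, rfl⟩ := hx
      exact Algebra.subset_adjoin ⟨i, rfl⟩
    | algebraMap r =>
      rw [Algebra.algebraMap_eq_smul_one, Matrix.conjTranspose_smul, Matrix.conjTranspose_one]
      exact Subalgebra.smul_mem _ (Subalgebra.one_mem _) _
    | add x y _ _ hx hy =>
      rw [Matrix.conjTranspose_add]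
      exact add_mem hx hy
    | mul x y _ _ hx hy =>
      rw [Matrix.conjTranspose_mul]
      exact mul_mem hy hx
  have := key Aᴴ (hgen ▸ Algebra.mem_top)
  rwa [Matrix.conjTranspose_conjTranspose] at this

/-- A subspace that is invariant under the generators of the full matrix algebra is trivial. -/
lemma eq_bot_or_eq_top_of_invariant (hgen : Algebra.adjoin ℂ (Set.range X) = ⊤)
    (K : Submodule ℂ (Fin n → ℂ)) (hK : ∀ i, ∀ x ∈ K, X i *ᵥ x ∈ K) : K = ⊥ ∨ K = ⊤ := by
  have key : ∀ A : Matrix (Fin n) (Fin n) ℂ, ∀ x ∈ K, A *ᵥ x ∈ K := by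
    intro A
    have hA : A ∈ Algebra.adjoin ℂ (Set.range X) := hgen ▸ Algebra.mem_top
    induction hA using Algebra.adjoin_induction with
    | mem x hx =>
      obtain ⟨i, rfl⟩ := hx
      exact hK i
    | algebraMap r =>
      intro x hx
      rw [Algebra.algebraMap_eq_smul_one, Matrix.smul_mulVec, Matrix.one_mulVec]
      exact K.smul_mem _ hx
    | add A B _ _ hA hB =>
      intro x hx
      rw [Matrix.add_mulVec]
      exact K.add_mem (hA x hx) (hB x hx)
    | mul A B _ _ hA hB =>
      intro x hx
      rw [← Matrix.mulVec_mulVec]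
      exact hA _ (hB x hx)
  by_contra! h
  obtain ⟨x, hx, hx0⟩ := (Submodule.ne_bot_iff K).mp h.1
  refine h.2 (eq_top_iff.mpr fun y _ => ?_)
  have hpos : star x ⬝ᵥ x ≠ 0 := fun h0 => hx0 (dotProduct_star_self_eq_zero.mp h0)
  -- The rank one matrix `y x*` moves a nonzero `x` to any prescribed `y`, up to a scalar.
  have := key (Matrix.vecMulVec y (star x)) ((star x ⬝ᵥ x)⁻¹ • x) (K.smul_mem _ hx)
  rw [Matrix.mulVec_smul, Matrix.vecMulVec_mulVec] at this
  simpa [smul_smul, inv_mul_cancel₀ hpos] using this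

/-- A vanishing sum of nonnegative quadratic forms vanishes termwise, and the form of `Xᵢ A Xᵢ*` at
`x` is that of `A` at `Xᵢ* x`. -/
lemma mulVec_eq_zero_of_add_krausMap {A : Matrix (Fin n) (Fin n) ℂ} (hA : A.PosSemidef)
    {x : Fin n → ℂ} (hx : (A + krausMap X A) *ᵥ x = 0) :
    A *ᵥ x = 0 ∧ ∀ i, A *ᵥ ((X i)ᴴ *ᵥ x) = 0 := by
  have h1 := congrArg (star x ⬝ᵥ ·) hx
  simp only [Matrix.add_mulVec, krausMap, Matrix.sum_mulVec, dotProduct_add, dotProduct_sum,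
    dotProduct_zero] at h1
  have hi : ∀ i, 0 ≤ star x ⬝ᵥ ((X i * A * (X i)ᴴ) *ᵥ x) := fun i =>
    (hA.mul_mul_conjTranspose_same (X i)).dotProduct_mulVec_nonneg x
  have h2 := (add_eq_zero_iff_of_nonneg (hA.dotProduct_mulVec_nonneg x)
    (Finset.sum_nonneg fun i _ => hi i)).mp h1
  refine ⟨(hA.dotProduct_mulVec_zero_iff x).mp h2.1, fun i => ?_⟩
  have h3 := (Finset.sum_eq_zero_iff_of_nonneg fun i _ => hi i).mp h2.2 i (Finset.mem_univ i)
  rw [← hA.dotProduct_mulVec_zero_iff, ← h3, Matrix.star_mulVec,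
    Matrix.conjTranspose_conjTranspose, ← Matrix.dotProduct_mulVec]
  simp only [Matrix.mulVec_mulVec, mul_assoc]

lemma posSemidef_iterate_add_krausMap {A : Matrix (Fin n) (Fin n) ℂ} (hA : A.PosSemidef) (k : ℕ) :
    ((fun B => B + krausMap X B)^[k] A).PosSemidef := by
  induction k with
  | zero => exact hA
  | succ k ih =>
    rw [Function.iterate_succ_apply']
    exact ih.add (posSemidef_krausMap ih)

/-- Irreducibility: a power of `1 + φ` maps a nonzero positive semidefinite matrix to a positive
definite one. -/
lemma exists_iterate_posDef (hgen : Algebra.adjoin ℂ (Set.range X) = ⊤)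
    {A : Matrix (Fin n) (Fin n) ℂ} (hA : A.PosSemidef) (hA0 : A ≠ 0) :
    ∃ k : ℕ, ((fun B => B + krausMap X B)^[k] A).PosDef := by
  set F := fun k : ℕ => (fun B => B + krausMap X B)^[k] A with hF
  have hpos : ∀ k, (F k).PosSemidef := posSemidef_iterate_add_krausMap hA
  have hsucc : ∀ k, F (k + 1) = F k + krausMap X (F k) := fun k =>
    Function.iterate_succ_apply' _ k A
  let K : ℕ → Submodule ℂ (Fin n → ℂ) := fun k => LinearMap.ker (F k).mulVecLin
  have hK : Antitone K := antitone_nat_of_succ_le fun k x hx => by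
    simp only [K, LinearMap.mem_ker, Matrix.mulVecLin_apply] at hx ⊢
    rw [hsucc] at hx
    exact (mulVec_eq_zero_of_add_krausMap (hpos k) hx).1
  -- The kernels decrease, so they stabilize; a stable kernel is invariant under all `Xᵢ*`, hence
  -- trivial.
  obtain ⟨N, hN⟩ := IsArtinian.monotone_stabilizes
    (⟨fun k => OrderDual.toDual (K k), fun _ _ h => hK h⟩ : ℕ →o (Submodule ℂ (Fin n → ℂ))ᵒᵈ)
  have hN' : K N = K (N + 1) := congrArg OrderDual.ofDual (hN (N + 1) (Nat.le_succ N))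
  have hinv : ∀ i, ∀ x ∈ K N, (X i)ᴴ *ᵥ x ∈ K N := by
    intro i x hx
    rw [hN'] at hx
    simp only [K, LinearMap.mem_ker, Matrix.mulVecLin_apply] at hx ⊢
    rw [hsucc] at hx
    exact (mulVec_eq_zero_of_add_krausMap (hpos N) hx).2 i
  refine ⟨N, ?_⟩
  change (F N).PosDef
  rcases eq_bot_or_eq_top_of_invariant (adjoin_range_conjTranspose hgen) (K N) hinv with h | h
  · rw [(hpos N).posDef_iff_isUnit, ← Matrix.mulVec_injective_iff_isUnit,
      ← Matrix.coe_mulVecLin, ← LinearMap.ker_eq_bot]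
    exact h
  · refine absurd ?_ hA0
    have h0 : K 0 = ⊤ := top_le_iff.mp (h ▸ hK (Nat.zero_le N))
    have h1 : A.mulVecLin = 0 := LinearMap.ker_eq_top.mp h0
    exact Matrix.toLin'.injective (a₁ := A) (a₂ := 0)
      (by simpa [Matrix.toLin'_apply'] using h1)

lemma _root_.Matrix.PosDef.posDef_sqrt {V : Matrix (Fin n) (Fin n) ℂ} (hV : V.PosDef) :
    (CFC.sqrt V).PosDef :=
  Matrix.isStrictlyPositive_iff_posDef.mp (Matrix.isStrictlyPositive_iff_posDef.mpr hV).sqrt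

lemma _root_.Matrix.PosDef.sqrt_mul_sqrt {V : Matrix (Fin n) (Fin n) ℂ} (hV : V.PosDef) :
    CFC.sqrt V * CFC.sqrt V = V :=
  CFC.sqrt_mul_sqrt_self V hV.posSemidef.nonneg

section

open scoped Matrix.Norms.L2Operator

/-- Congruence by `D^{-1/2}` reduces to `D = 1`, where `H` becomes `G ≤ ‖G‖`. The choice `ε = 1 /
(‖G‖ + 1)` also covers `H = 0`. -/
lemma _root_.Matrix.PosDef.exists_sub_smul_posSemidef {D H : Matrix (Fin n) (Fin n) ℂ}
    (hD : D.PosDef) (hH : H.PosSemidef) : ∃ ε : ℝ, 0 < ε ∧ (D - ε • H).PosSemidef := by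
  set S := CFC.sqrt D with hS
  have hSp : S.PosDef := hD.posDef_sqrt
  have hdet : IsUnit S.det := (Matrix.isUnit_iff_isUnit_det S).mp hSp.isUnit
  set G := S⁻¹ * H * S⁻¹ with hG
  have hSi : (S⁻¹)ᴴ = S⁻¹ := hSp.inv.isHermitian
  have hGp : G.PosSemidef := by
    have := hH.mul_mul_conjTranspose_same S⁻¹
    rwa [hSi] at this
  have hle : G ≤ algebraMap ℝ _ ‖G‖ := IsSelfAdjoint.le_algebraMap_norm_self hGp.isHermitian
  refine ⟨(‖G‖ + 1)⁻¹, by positivity, ?_⟩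
  have h1 : ((1 : Matrix (Fin n) (Fin n) ℂ) - (‖G‖ + 1)⁻¹ • G).PosSemidef := by
    have h2 : (algebraMap ℝ (Matrix (Fin n) (Fin n) ℂ) ‖G‖ - G).PosSemidef := hle
    have h3 := (h2.add Matrix.PosSemidef.one).smul (a := (‖G‖ + 1)⁻¹) (by positivity)
    have h4 : (‖G‖ + 1)⁻¹ • (algebraMap ℝ (Matrix (Fin n) (Fin n) ℂ) ‖G‖ - G + 1) =
        1 - (‖G‖ + 1)⁻¹ • G := by
      have : (‖G‖ + 1)⁻¹ * ‖G‖ + (‖G‖ + 1)⁻¹ = 1 := by field_simp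
      rw [Algebra.algebraMap_eq_smul_one]
      calc _ = ((‖G‖ + 1)⁻¹ * ‖G‖ + (‖G‖ + 1)⁻¹) • (1 : Matrix (Fin n) (Fin n) ℂ) -
            (‖G‖ + 1)⁻¹ • G := by module
        _ = _ := by rw [this, one_smul]
    rwa [h4] at h3
  have h5 := h1.mul_mul_conjTranspose_same S
  have h6 : S * (1 - (‖G‖ + 1)⁻¹ • G) * Sᴴ = D - (‖G‖ + 1)⁻¹ • H := by
    have h7 : S * G * S = H := by
      rw [hG, ← mul_assoc, ← mul_assoc, Matrix.mul_nonsing_inv _ hdet, one_mul, mul_assoc,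
        Matrix.nonsing_inv_mul _ hdet, mul_one]
    rw [hSp.isHermitian.eq, mul_sub, sub_mul, mul_one, hD.sqrt_mul_sqrt, Matrix.mul_smul,
      Matrix.smul_mul, h7]
  rwa [h6] at h5

end

lemma isClosed_posSemidef : IsClosed {A : Matrix (Fin n) (Fin n) ℂ | A.PosSemidef} := by
  simp only [Matrix.posSemidef_iff_dotProduct_mulVec, Matrix.IsHermitian, Set.ofPred_and,
    Set.ofPred_forall]
  refine (isClosed_eq (by fun_prop) continuous_id).inter (isClosed_iInter fun x => ?_)
  exact isClosed_le continuous_const (by fun_prop)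

section

open scoped Matrix.Norms.Frobenius

/-- Perron–Frobenius: an irreducible completely positive map has a positive definite
eigenvector. -/
theorem exists_posDef_eigenvector [NeZero n] (hgen : Algebra.adjoin ℂ (Set.range X) = ⊤) :
    ∃ t : ℝ, 0 ≤ t ∧ ∃ V : Matrix (Fin n) (Fin n) ℂ, V.PosDef ∧ krausMap X V = t • V := by
  -- Collatz–Wielandt: maximize `t` subject to `φ(H) ≥ t H` with `H ≥ 0` nonzero. Writing `H = B* B`
  -- with `‖B‖ = 1` builds in positivity and makes the feasible set compact.
  set F : Set (ℝ × Matrix (Fin n) (Fin n) ℂ) :=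
    {p | 0 ≤ p.1 ∧ ‖p.2‖ = 1 ∧ (krausMap X (p.2ᴴ * p.2) - p.1 • (p.2ᴴ * p.2)).PosSemidef} with hF
  have hscale : ∀ (t : ℝ) (H : Matrix (Fin n) (Fin n) ℂ), 0 ≤ t → H.PosSemidef → H ≠ 0 →
      (krausMap X H - t • H).PosSemidef → ∃ B, (t, B) ∈ F := by
    intro t H ht hH hH0 hp
    obtain ⟨B, rfl⟩ := CStarAlgebra.nonneg_iff_eq_star_mul_self.mp hH.nonneg
    have hB : B ≠ 0 := by rintro rfl; simp at hH0
    refine ⟨‖B‖⁻¹ • B, ht, ?_, ?_⟩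
    · rw [norm_smul, norm_inv, norm_norm, inv_mul_cancel₀ (norm_ne_zero_iff.mpr hB)]
    have := hp.smul (a := ‖B‖⁻¹ * ‖B‖⁻¹) (by positivity)
    convert this using 1
    simp only [Matrix.conjTranspose_smul, star_trivial, Matrix.smul_mul, Matrix.mul_smul, smul_smul,
      krausMap_smul, smul_sub, Matrix.star_eq_conjTranspose]
    congr 2
    ring
  have htr : ∀ B : Matrix (Fin n) (Fin n) ℂ, B ≠ 0 → 0 < (Bᴴ * B).trace.re := by
    intro B hB
    have h1 := (Matrix.posSemidef_conjTranspose_mul_self B).trace_nonneg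
    have h2 : (Bᴴ * B).trace ≠ 0 := fun h =>
      hB (Matrix.trace_conjTranspose_mul_self_eq_zero_iff.mp h)
    exact (Complex.pos_iff.mp (lt_of_le_of_ne h1 h2.symm)).1
  have hclosed : IsClosed F := by
    refine (isClosed_le continuous_const continuous_fst).inter
      ((isClosed_eq continuous_snd.norm continuous_const).inter
      (isClosed_posSemidef.preimage ?_))
    have := continuous_krausMap (X := X)
    fun_prop
  -- Taking traces in `φ(H) ≥ t H` bounds `t` by `tr φ(H) / tr H`, which is continuous on the
  -- sphere.
  obtain ⟨M, hM⟩ := (isCompact_sphere (0 : Matrix (Fin n) (Fin n) ℂ) 1).bddAbove_image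
    (f := fun B => (krausMap X (Bᴴ * B)).trace.re / (Bᴴ * B).trace.re) (by
      refine ContinuousOn.div ?_ ?_ ?_
      · have := continuous_krausMap (X := X)
        fun_prop
      · fun_prop
      · intro B hB
        exact (htr B (by rintro rfl; simp at hB)).ne')
  have hcompact : IsCompact F := by
    refine ((isCompact_Icc (a := (0 : ℝ)) (b := M)).prod
      (isCompact_sphere (0 : Matrix (Fin n) (Fin n) ℂ) 1)).of_isClosed_subset hclosed ?_
    rintro ⟨t, B⟩ ⟨ht, hB, hp⟩
    have hB' : B ∈ Metric.sphere (0 : Matrix (Fin n) (Fin n) ℂ) 1 := by simpa using hB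
    refine ⟨⟨ht, ?_⟩, hB'⟩
    refine le_trans ?_ (hM ⟨B, hB', rfl⟩)
    rw [le_div_iff₀ (htr B (by rintro rfl; simp at hB))]
    have := (Complex.nonneg_iff.mp hp.trace_nonneg).1
    simpa [Matrix.trace_sub, Matrix.trace_smul] using this
  have hne : F.Nonempty := by
    obtain ⟨B, hB⟩ := hscale 0 1 le_rfl Matrix.PosSemidef.one one_ne_zero (by
      simpa using posSemidef_krausMap Matrix.PosSemidef.one)
    exact ⟨_, hB⟩
  obtain ⟨⟨t, B⟩, ⟨ht, hB, hp⟩, hmax⟩ := hcompact.exists_isMaxOn hne continuous_fst.continuousOn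
  simp only at ht hB hp
  set H := Bᴴ * B with hH
  have hHp : H.PosSemidef := Matrix.posSemidef_conjTranspose_mul_self B
  have hH0 : H ≠ 0 := by
    rw [hH, Ne, Matrix.conjTranspose_mul_self_eq_zero]
    rintro rfl
    simp at hB
  set ψ := fun A => A + krausMap X A with hψ
  -- If the defect were nonzero, a power of `1 + φ` would make it positive definite. It would then
  -- dominate a small multiple of the transformed `H`, making `t + ε` feasible.
  have heig : krausMap X H - t • H = 0 := by
    by_contra hD0
    obtain ⟨N, hN⟩ := exists_iterate_posDef hgen hp hD0
    have hcomm : ∀ k, ψ^[k] (krausMap X H - t • H) =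
        krausMap X (ψ^[k] H) - t • ψ^[k] H := by
      intro k
      induction k with
      | zero => rfl
      | succ k ih =>
        rw [Function.iterate_succ_apply', Function.iterate_succ_apply', ih]
        simp only [hψ, krausMap_add, krausMap_sub, krausMap_smul, smul_add]
        abel
    change (ψ^[N] _).PosDef at hN
    have hHN : (ψ^[N] H).PosSemidef := posSemidef_iterate_add_krausMap hHp N
    obtain ⟨ε, hε, hεp⟩ := hN.exists_sub_smul_posSemidef hHN
    have hHN0 : ψ^[N] H ≠ 0 := by
      intro h0
      rw [hcomm, h0] at hN
      have h1 : krausMap X (0 : Matrix (Fin n) (Fin n) ℂ) = 0 := by simp [krausMap]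
      rw [h1, smul_zero, sub_zero] at hN
      exact absurd hN.isUnit not_isUnit_zero
    obtain ⟨B', hB'⟩ := hscale (t + ε) (ψ^[N] H) (by positivity) hHN hHN0 (by
      rw [hcomm] at hεp
      rwa [add_smul, ← sub_sub])
    have : t + ε ≤ t := hmax hB'
    linarith
  have heig' : krausMap X H = t • H := sub_eq_zero.mp heig
  obtain ⟨N, hN⟩ := exists_iterate_posDef hgen hHp hH0
  change (ψ^[N] H).PosDef at hN
  refine ⟨t, ht, ψ^[N] H, hN, ?_⟩
  -- The positive definite iterate is a multiple of `H`, hence itself an eigenvector.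
  have : ∀ k, ψ^[k] H = (1 + t) ^ k • H := by
    intro k
    induction k with
    | zero => simp
    | succ k ih =>
      rw [Function.iterate_succ_apply', ih]
      simp only [hψ, krausMap_smul, heig']
      module
  rw [this, krausMap_smul, heig', smul_comm]

end

end PerronFrobenius

/-! ### Contraction in the weighted Hilbert norm, and fixed points -/

section Contraction

open scoped Matrix.Norms.Frobenius

variable {n d : ℕ} {X : Fin d → Matrix (Fin n) (Fin n) ℂ} {V W : Matrix (Fin n) (Fin n) ℂ}

lemma frobenius_norm_sq (A : Matrix (Fin n) (Fin n) ℂ) : ‖A‖ ^ 2 = ∑ i, ∑ j, ‖A i j‖ ^ 2 := by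
  rw [Matrix.frobenius_norm_def, ← Real.rpow_natCast, ← Real.rpow_mul (by positivity)]
  norm_num

lemma norm_sq_eq_trace (A : Matrix (Fin n) (Fin n) ℂ) : (A * Aᴴ).trace = ((‖A‖ ^ 2 : ℝ) : ℂ) := by
  rw [frobenius_norm_sq]
  push_cast
  simp only [Matrix.trace, Matrix.diag, Matrix.mul_apply, Matrix.conjTranspose_apply,
    Complex.star_def, Complex.mul_conj']

lemma norm_entry_le (A : Matrix (Fin n) (Fin n) ℂ) (i j : Fin n) : ‖A i j‖ ≤ ‖A‖ := by
  refine abs_le_of_sq_le_sq' ?_ (norm_nonneg A) |>.2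
  rw [frobenius_norm_sq]
  exact (Finset.single_le_sum (f := fun j => ‖A i j‖ ^ 2) (fun _ _ => by positivity)
    (Finset.mem_univ j)).trans (Finset.single_le_sum (f := fun i => ∑ j, ‖A i j‖ ^ 2)
      (fun _ _ => by positivity) (Finset.mem_univ i))

/-- The Hilbert norm on matrices weighted by `W` on the left and `V⁻¹` on the right. -/
noncomputable def weightedNorm (V W Z : Matrix (Fin n) (Fin n) ℂ) : ℝ :=
  ‖CFC.sqrt W * Z * (CFC.sqrt V)⁻¹‖

/-- The trace form lets `φ` be moved onto `W` by `trace_mul_krausMap`. -/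
lemma trace_eq_weightedNorm_sq (hV : V.PosDef) (hW : W.PosDef) (Z : Matrix (Fin n) (Fin n) ℂ) :
    (W * (Z * V⁻¹ * Zᴴ)).trace = ((weightedNorm V W Z ^ 2 : ℝ) : ℂ) := by
  rw [weightedNorm, ← norm_sq_eq_trace]
  have h1 : ((CFC.sqrt V)⁻¹)ᴴ = (CFC.sqrt V)⁻¹ := hV.posDef_sqrt.inv.isHermitian
  have h2 : (CFC.sqrt V)⁻¹ * (CFC.sqrt V)⁻¹ = V⁻¹ := by
    rw [← Matrix.mul_inv_rev, hV.sqrt_mul_sqrt]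
  rw [Matrix.conjTranspose_mul, Matrix.conjTranspose_mul, h1, hW.posDef_sqrt.isHermitian.eq,
    ← h2]
  nth_rw 1 [← hW.sqrt_mul_sqrt]
  rw [mul_assoc (CFC.sqrt W), Matrix.trace_mul_comm]
  simp only [mul_assoc]

lemma weightedNorm_eq_zero (hV : V.PosDef) (hW : W.PosDef) {Z : Matrix (Fin n) (Fin n) ℂ}
    (h : weightedNorm V W Z = 0) : Z = 0 := by
  rw [weightedNorm, norm_eq_zero] at h
  have h1 := hV.posDef_sqrt.isUnit
  rw [← Matrix.isUnit_nonsing_inv_iff] at h1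
  exact (hW.posDef_sqrt.isUnit.mul_right_eq_zero).mp (h1.mul_left_eq_zero.mp h)

lemma norm_le_weightedNorm (hV : V.PosDef) (hW : W.PosDef) (Z : Matrix (Fin n) (Fin n) ℂ) :
    ‖Z‖ ≤ ‖(CFC.sqrt W)⁻¹‖ * weightedNorm V W Z * ‖CFC.sqrt V‖ := by
  have h1 := (Matrix.isUnit_iff_isUnit_det _).mp hV.posDef_sqrt.isUnit
  have h2 := (Matrix.isUnit_iff_isUnit_det _).mp hW.posDef_sqrt.isUnit
  have h3 : Z = (CFC.sqrt W)⁻¹ * (CFC.sqrt W * Z * (CFC.sqrt V)⁻¹) * CFC.sqrt V := by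
    simp only [mul_assoc, Matrix.nonsing_inv_mul _ h1, mul_one]
    rw [← mul_assoc, Matrix.nonsing_inv_mul _ h2, one_mul]
  conv_lhs => rw [h3]
  refine (Matrix.frobenius_norm_mul _ _).trans ?_
  gcongr
  exact Matrix.frobenius_norm_mul _ _

/-- The Schwarz identity for a completely positive map with eigenvectors `V` and, for the adjoint
map, `W`. -/
lemma sum_weightedNorm_sq {t : ℝ} (hV : V.PosDef) (hW : W.PosDef) (hφV : krausMap X V = t • V)
    (hφW : krausMap (fun i => (X i)ᴴ) W = t • W) (Z : Matrix (Fin n) (Fin n) ℂ) :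
    ∑ i, weightedNorm V W (X i * Z - krausMap X Z * V⁻¹ * X i * V) ^ 2 =
      t * weightedNorm V W Z ^ 2 + (t - 2) * weightedNorm V W (krausMap X Z) ^ 2 := by
  have hdet : IsUnit V.det := (Matrix.isUnit_iff_isUnit_det _).mp hV.isUnit
  have hVh : Vᴴ = V := hV.isHermitian
  have hVi : (V⁻¹)ᴴ = V⁻¹ := hV.inv.isHermitian
  set P := krausMap X Z with hP
  have h1 : ∀ i, (X i * Z - P * V⁻¹ * X i * V) * V⁻¹ * (X i * Z - P * V⁻¹ * X i * V)ᴴ =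
      X i * (Z * V⁻¹ * Zᴴ) * (X i)ᴴ - (X i * Z * (X i)ᴴ) * (V⁻¹ * Pᴴ)
        - (P * V⁻¹) * (X i * Zᴴ * (X i)ᴴ) + (P * V⁻¹) * (X i * V * (X i)ᴴ) * (V⁻¹ * Pᴴ) := by
    intro i
    have e1 : ∀ A : Matrix (Fin n) (Fin n) ℂ, V⁻¹ * (V * A) = A := fun A => by
      rw [← mul_assoc, Matrix.nonsing_inv_mul _ hdet, one_mul]
    have e2 : ∀ A : Matrix (Fin n) (Fin n) ℂ, V * (V⁻¹ * A) = A := fun A => by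
      rw [← mul_assoc, Matrix.mul_nonsing_inv _ hdet, one_mul]
    simp only [Matrix.conjTranspose_sub, Matrix.conjTranspose_mul, hVh, hVi, sub_mul, mul_sub,
      mul_assoc, e1, e2]
    abel
  -- Each of the two cross terms sums to `-P V⁻¹ P*`, and the last term to `t P V⁻¹ P*` since `φ(V)
  -- = t V`; hence `t - 2`.
  have h2 : ∑ i, (X i * Z - P * V⁻¹ * X i * V) * V⁻¹ * (X i * Z - P * V⁻¹ * X i * V)ᴴ =
      krausMap X (Z * V⁻¹ * Zᴴ) + (t - 2) • (P * V⁻¹ * Pᴴ) := by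
    simp only [h1, Finset.sum_add_distrib, Finset.sum_sub_distrib, ← Finset.sum_mul,
      ← Finset.mul_sum]
    change krausMap X _ - krausMap X Z * _ - _ * krausMap X Zᴴ + _ * krausMap X V * _ = _
    rw [krausMap_conjTranspose, hφV, ← hP]
    have e3 : P * V⁻¹ * (t • V) * (V⁻¹ * Pᴴ) = t • (P * V⁻¹ * Pᴴ) := by
      rw [Matrix.mul_smul, Matrix.smul_mul, mul_assoc P, Matrix.nonsing_inv_mul _ hdet, mul_one,
        mul_assoc]
    rw [e3, ← mul_assoc]
    module
  have h3 := congrArg (fun A => (W * A).trace) h2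
  simp only [Finset.mul_sum, Matrix.trace_sum, trace_eq_weightedNorm_sq hV hW, mul_add,
    Matrix.trace_add, trace_mul_krausMap, hφW, Matrix.mul_smul, Matrix.smul_mul,
    Matrix.trace_smul] at h3
  have h4 := congrArg Complex.re h3
  simpa [Complex.re_sum, ← Complex.ofReal_pow, ← Complex.ofReal_sum] using h4

lemma weightedNorm_iterate_le (hV : V.PosDef) (hW : W.PosDef) (hφV : krausMap X V = V)
    (hφW : krausMap (fun i => (X i)ᴴ) W = W) (Z : Matrix (Fin n) (Fin n) ℂ) (k : ℕ) :
    weightedNorm V W ((krausMap X)^[k] Z) ≤ weightedNorm V W Z := by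
  induction k with
  | zero => exact le_rfl
  | succ k ih =>
    rw [Function.iterate_succ_apply']
    refine le_trans ?_ ih
    have h1 := sum_weightedNorm_sq (t := 1) hV hW (by simpa using hφV) (by simpa using hφW)
      ((krausMap X)^[k] Z)
    have h2 : 0 ≤ ∑ i, weightedNorm V W (X i * (krausMap X)^[k] Z -
        krausMap X ((krausMap X)^[k] Z) * V⁻¹ * X i * V) ^ 2 :=
      Finset.sum_nonneg fun _ _ => sq_nonneg _
    have h3 : weightedNorm V W (krausMap X ((krausMap X)^[k] Z)) ^ 2 ≤
        weightedNorm V W ((krausMap X)^[k] Z) ^ 2 := by linarith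
    exact (abs_le_of_sq_le_sq' h3 (norm_nonneg _)).2

/-- The fixed points of an irreducible map are the multiples of `V`. -/
lemma exists_smul_of_krausMap_eq (hgen : Algebra.adjoin ℂ (Set.range X) = ⊤) (hV : V.PosDef)
    (hW : W.PosDef) (hφV : krausMap X V = V) (hφW : krausMap (fun i => (X i)ᴴ) W = W)
    {Z : Matrix (Fin n) (Fin n) ℂ} (hZ : krausMap X Z = Z) : ∃ c : ℂ, Z = c • V := by
  have hdet : IsUnit V.det := (Matrix.isUnit_iff_isUnit_det _).mp hV.isUnit
  have h1 := sum_weightedNorm_sq (t := 1) hV hW (by simpa using hφV) (by simpa using hφW) Z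
  rw [hZ, show 1 * weightedNorm V W Z ^ 2 + (1 - 2) * weightedNorm V W Z ^ 2 = 0 by ring,
    Finset.sum_eq_zero_iff_of_nonneg fun _ _ => sq_nonneg _] at h1
  -- Every square vanishes, that is, `Xᵢ Z = Z V⁻¹ Xᵢ V`.
  have h2 : ∀ i, Commute (Z * V⁻¹) (X i) := by
    intro i
    have h3 := weightedNorm_eq_zero hV hW 
      (pow_eq_zero_iff two_ne_zero |>.mp (h1 i (Finset.mem_univ i)))
    have h4 := congrArg (· * V⁻¹) (sub_eq_zero.mp h3)
    simp only [mul_assoc, Matrix.mul_nonsing_inv _ hdet, mul_one] at h4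
    rw [Commute, SemiconjBy, mul_assoc, ← h4]
  have h3 : Z * V⁻¹ ∈ Set.center (Matrix (Fin n) (Fin n) ℂ) := by
    rw [Semigroup.mem_center_iff]
    intro A
    have hA : A ∈ Algebra.adjoin ℂ (Set.range X) := hgen ▸ Algebra.mem_top
    have : Commute (Z * V⁻¹) A := by
      induction hA using Algebra.adjoin_induction with
      | mem x hx =>
        obtain ⟨i, rfl⟩ := hx
        exact h2 i
      | algebraMap r => exact (Algebra.commutes r _).symm
      | add A B _ _ hA hB => exact hA.add_right hB
      | mul A B _ _ hA hB => exact hA.mul_right hB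
    exact this.eq.symm
  rw [Matrix.center_eq_range] at h3
  obtain ⟨c, hc⟩ := h3
  refine ⟨c, ?_⟩
  have h4 := congrArg (· * V) hc
  simp only [mul_assoc, Matrix.nonsing_inv_mul _ hdet, mul_one] at h4
  rw [← h4, Matrix.scalar_apply, ← Matrix.smul_eq_diagonal_mul]

lemma pow_mulVec_vec (k : ℕ) (Z : Matrix (Fin n) (Fin n) ℂ) :
    (transferMatrix X ^ k) *ᵥ Z.vec = ((krausMap X)^[k] Z).vec := by
  induction k with
  | zero => simp
  | succ k ih =>
    rw [pow_succ', ← Matrix.mulVec_mulVec, ih, transferMatrix_mulVec_vec,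
      Function.iterate_succ_apply']

lemma trace_mul_pos [NeZero n] (hV : V.PosDef) (hW : W.PosDef) :
    ∃ τ : ℝ, 0 < τ ∧ (W * V).trace = τ := by
  have h := trace_eq_weightedNorm_sq hV hW V
  rw [Matrix.mul_nonsing_inv _ ((Matrix.isUnit_iff_isUnit_det _).mp hV.isUnit), one_mul,
    hV.isHermitian.eq] at h
  refine ⟨_, ?_, h⟩
  have : 0 < weightedNorm V W V :=
    lt_of_le_of_ne (norm_nonneg _) fun h => hV.isUnit.ne_zero (weightedNorm_eq_zero hV hW h.symm)
  positivity

lemma exists_norm_iterate_entry_le (hV : V.PosDef) (hW : W.PosDef) (hφV : krausMap X V = V)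
    (hφW : krausMap (fun i => (X i)ᴴ) W = W) (Z : Matrix (Fin n) (Fin n) ℂ) :
    ∃ C : ℝ, ∀ k i j, ‖((krausMap X)^[k] Z) i j‖ ≤ C := by
  refine ⟨‖(CFC.sqrt W)⁻¹‖ * weightedNorm V W Z * ‖CFC.sqrt V‖, fun k i j => ?_⟩
  refine (norm_entry_le _ _ _).trans ((norm_le_weightedNorm hV hW _).trans ?_)
  gcongr
  exact weightedNorm_iterate_le hV hW hφV hφW Z k

/-- The fixed points of the transfer map and its adjoint in the irreducible case. -/
theorem exists_fixed_points (hρ : outerSpectralRadius X = 1)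
    (hgen : Algebra.adjoin ℂ (Set.range X) = ⊤) :
    spectralRadius ℂ (transferMatrix X) = 1 ∧ ∃ V W : Matrix (Fin n) (Fin n) ℂ,
      V.PosDef ∧ W.PosDef ∧ krausMap X V = V ∧ krausMap (fun i => (X i)ᴴ) W = W ∧
        (W * V).trace = 1 := by
  have hsr : spectralRadius ℂ (transferMatrix X) = 1 := by
    rw [outerSpectralRadius, Real.sqrt_eq_one] at hρ
    exact (ENNReal.toReal_eq_one_iff _).mp hρ
  refine ⟨hsr, ?_⟩
  -- For `n = 0` the spectrum is empty and the spectral radius is zero.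
  have hn : NeZero n := by
    refine ⟨?_⟩
    rintro rfl
    simp [spectralRadius, spectrum.of_subsingleton] at hsr
  obtain ⟨t, ht, V, hV, hφV⟩ := exists_posDef_eigenvector hgen
  obtain ⟨s, hs, W, hW, hφW⟩ := exists_posDef_eigenvector (adjoin_range_conjTranspose hgen)
  have hN : ∀ {Z : Matrix (Fin n) (Fin n) ℂ}, Z ≠ 0 → 0 < weightedNorm V W Z := fun hZ =>
    lt_of_le_of_ne (norm_nonneg _) fun h => hZ (weightedNorm_eq_zero hV hW h.symm)
  have hst : s = t := by
    have h1 := trace_mul_krausMap (X := X) W V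
    rw [hφV, hφW, Matrix.mul_smul, Matrix.smul_mul, Matrix.trace_smul, Matrix.trace_smul] at h1
    obtain ⟨τ, hτ, hτ'⟩ := trace_mul_pos hV hW
    have h2 : (W * V).trace ≠ 0 := by
      rw [hτ']
      exact_mod_cast hτ.ne'
    exact (smul_left_injective ℝ h2 h1).symm
  rw [hst] at hφW
  have heq : t = 1 := by
    apply le_antisymm
    · have h1 : (t : ℂ) ∈ spectrum ℂ (transferMatrix X) := by
        refine mem_spectrum_iff_exists_mulVec.mpr ⟨V.vec, ?_, ?_⟩
        · rw [Ne, Matrix.vec_eq_zero_iff]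
          exact hV.isUnit.ne_zero
        · rw [transferMatrix_mulVec_vec, hφV, Matrix.vec_smul]
          rfl
      have h2 : (‖(t : ℂ)‖₊ : ℝ≥0∞) ≤ spectralRadius ℂ (transferMatrix X) :=
        le_iSup₂ (f := fun k (_ : k ∈ spectrum ℂ (transferMatrix X)) => (‖k‖₊ : ℝ≥0∞)) _ h1
      rw [hsr] at h2
      have h3 : ‖(t : ℂ)‖₊ ≤ 1 := by exact_mod_cast h2
      have h4 : ‖(t : ℂ)‖ ≤ 1 := h3
      rwa [Complex.norm_of_nonneg ht] at h4
    -- For a peripheral eigenvector `Z` the Schwarz identity reads `0 ≤ (2t - 2)‖Z‖²`.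
    · have hne : Nonempty (Fin n × Fin n) := ⟨(0, 0)⟩
      obtain ⟨μ, hμ, hμ1⟩ := spectrum.exists_nnnorm_eq_spectralRadius (transferMatrix X)
      rw [hsr] at hμ1
      have hμ2 : ‖μ‖ = 1 := by
        have h3 : ‖μ‖₊ = 1 := by exact_mod_cast hμ1
        exact congrArg NNReal.toReal h3
      obtain ⟨u, hu, hTu⟩ := mem_spectrum_iff_exists_mulVec.mp hμ
      obtain ⟨Z, rfl⟩ := Matrix.vec_bijective.surjective u
      rw [transferMatrix_mulVec_vec, ← Matrix.vec_smul, Matrix.vec_inj] at hTu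
      have hZ : Z ≠ 0 := by
        rintro rfl
        simp at hu
      have h4 := sum_weightedNorm_sq hV hW hφV hφW Z
      have h5 : weightedNorm V W (krausMap X Z) = weightedNorm V W Z := by
        rw [hTu, weightedNorm, weightedNorm, Matrix.mul_smul, Matrix.smul_mul, norm_smul, hμ2,
          one_mul]
      have h6 : 0 ≤ ∑ i, weightedNorm V W (X i * Z - krausMap X Z * V⁻¹ * X i * V) ^ 2 :=
        Finset.sum_nonneg fun _ _ => sq_nonneg _
      rw [h4, h5] at h6
      have := hN hZ
      by_contra! hlt
      have h7 : 0 < weightedNorm V W Z ^ 2 := by positivity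
      nlinarith
  obtain ⟨τ, hτ, hτ'⟩ := trace_mul_pos hV hW
  rw [heq, one_smul] at hφV hφW
  refine ⟨τ⁻¹ • V, W, hV.smul (by positivity), hW, ?_, hφW, ?_⟩
  · rw [krausMap_smul, hφV]
  · rw [Matrix.mul_smul, Matrix.trace_smul, hτ', Complex.real_smul, ← Complex.ofReal_mul,
      inv_mul_cancel₀ hτ.ne', Complex.ofReal_one]

end Contraction

/-! ### Ergodicity of the transfer matrix -/

section

open scoped Matrix.Norms.Operator

lemma exists_norm_pow_le {ι : Type*} [Fintype ι] [DecidableEq ι] {T : Matrix ι ι ℂ}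
    (h : ∀ j i, ∃ C : ℝ, ∀ k : ℕ, ‖(T ^ k) i j‖ ≤ C) : ∃ C : ℝ, ∀ k : ℕ, ‖T ^ k‖ ≤ C := by
  choose C hC using h
  refine ⟨∑ i, ∑ j, C j i * ‖Matrix.single i j (1 : ℂ)‖, fun k => ?_⟩
  rw [Matrix.matrix_eq_sum_single (T ^ k)]
  refine (norm_sum_le _ _).trans (Finset.sum_le_sum fun i _ => (norm_sum_le _ _).trans
    (Finset.sum_le_sum fun j _ => ?_))
  have h1 : Matrix.single i j ((T ^ k) i j) = (T ^ k) i j • Matrix.single i j (1 : ℂ) := by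
    rw [Matrix.smul_single, smul_eq_mul, mul_one]
  rw [h1, norm_smul]
  gcongr
  exact hC j i k

/-- The transfer matrix is ergodic. -/
theorem isErgodic_transferMatrix {n d : ℕ} {X : Fin d → Matrix (Fin n) (Fin n) ℂ}
    (hgen : Algebra.adjoin ℂ (Set.range X) = ⊤) {V W : Matrix (Fin n) (Fin n) ℂ} (hV : V.PosDef)
    (hW : W.PosDef) (hφV : krausMap X V = V) (hφW : krausMap (fun i => (X i)ᴴ) W = W)
    (htr : (W * V).trace = 1) : IsErgodic (transferMatrix X) V.vec (star W.vec) where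
  bounded := by
    refine exists_norm_pow_le fun j i => ?_
    obtain ⟨Z, hZ⟩ := Matrix.vec_bijective.surjective (Pi.single j (1 : ℂ))
    obtain ⟨C, hC⟩ := exists_norm_iterate_entry_le hV hW hφV hφW Z
    refine ⟨C, fun k => ?_⟩
    -- Column `j` of `T ^ k` is the vectorized orbit of a matrix unit; column stacking swaps the two
    -- indices.
    have h1 : (transferMatrix X ^ k) i j = ((krausMap X)^[k] Z) i.2 i.1 := by
      have := congrFun (pow_mulVec_vec (X := X) k Z) i
      rw [hZ, Matrix.mulVec_single_one] at this
      exact this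
    rw [h1]
    exact hC k _ _
  mulVec_eq := by rw [transferMatrix_mulVec_vec, hφV]
  vecMul_eq := by rw [star_vec_vecMul_transferMatrix, hφW]
  dotProduct_eq := by rw [Matrix.star_vec_dotProduct_vec, hW.isHermitian.eq, htr]
  fixed := by
    intro u hu
    obtain ⟨Z, rfl⟩ := Matrix.vec_bijective.surjective u
    rw [transferMatrix_mulVec_vec, Matrix.vec_inj] at hu
    obtain ⟨c, rfl⟩ := exists_smul_of_krausMap_eq hgen hV hW hφV hφW hu
    exact ⟨c, Matrix.vec_smul c V⟩

end

/-! ### Normalizing sequences and their averages -/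

section Normalizations

open scoped Matrix.Norms.Operator

variable {ι : Type*} [Fintype ι] [DecidableEq ι]

lemma continuous_seminorm_matrix (p : Seminorm ℂ (Matrix ι ι ℂ)) : Continuous p := by
  have hle : ∀ A, p A ≤ ∑ i, ∑ j, ‖A i j‖ * p (Matrix.single i j 1) := by
    intro A
    conv_lhs => rw [Matrix.matrix_eq_sum_single A]
    have hsum := fun (f : ι → Matrix ι ι ℂ) =>
      Finset.le_sum_of_subadditive p (map_zero p).le (map_add_le_add p) Finset.univ f
    refine (hsum _).trans (Finset.sum_le_sum fun i _ => (hsum _).trans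
      (Finset.sum_le_sum fun j _ => ?_))
    rw [← map_smul_eq_mul p, Matrix.smul_single, smul_eq_mul, mul_one]
  rw [continuous_iff_continuousAt]
  intro A
  rw [ContinuousAt, tendsto_iff_norm_sub_tendsto_zero]
  have hlim : Tendsto (fun B : Matrix ι ι ℂ => ∑ i, ∑ j, ‖(B - A) i j‖ * p (Matrix.single i j 1))
      (𝓝 A) (𝓝 (∑ i, ∑ j, ‖(A - A) i j‖ * p (Matrix.single i j 1))) := by
    refine Continuous.tendsto ?_ A
    simp only [Matrix.sub_apply]
    fun_prop
  simp only [sub_self, Matrix.zero_apply, norm_zero, zero_mul, Finset.sum_const_zero] at hlim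
  exact squeeze_zero (fun _ => norm_nonneg _)
    (fun B => (abs_sub_map_le_sub p B A).trans (hle _)) hlim

namespace IsErgodic

variable {T : Matrix ι ι ℂ} {v w : ι → ℂ} {c : ℕ → ℝ}

lemma exists_bounds_of_isNormGrowth (h : IsErgodic T v w) (hc : IsNormGrowth T c) :
    ∃ δ M : ℝ, 0 < δ ∧ ∀ k, δ ≤ c k ∧ c k ≤ M := by
  obtain ⟨p, hp, hcp⟩ := hc
  obtain ⟨C, hC⟩ := h.bounded
  have hpc := continuous_seminorm_matrix p
  -- A compact set containing all powers but not `0`, because its members fix `v ≠ 0`; a norm is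
  -- bounded away from zero on it.
  set K : Set (Matrix ι ι ℂ) := {A | ‖A‖ ≤ C ∧ A *ᵥ v = v} with hK
  have hmem : ∀ k, T ^ k ∈ K := fun k => ⟨hC k, h.pow_mulVec k⟩
  have hcomp : IsCompact K := by
    refine (isCompact_closedBall (0 : Matrix ι ι ℂ) C).of_isClosed_subset ?_ ?_
    · exact (isClosed_le continuous_norm continuous_const).inter
        (isClosed_eq (by fun_prop) continuous_const)
    · intro A hA
      simpa using hA.1
  obtain ⟨A, hA, hmin⟩ := hcomp.exists_isMinOn ⟨_, hmem 0⟩ hpc.continuousOn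
  obtain ⟨M, hM⟩ := hcomp.bddAbove_image hpc.continuousOn
  refine ⟨p A, M, lt_of_le_of_ne (apply_nonneg p A) fun h0 => h.ne_zero ?_, fun k => ?_⟩
  · rw [← hA.2, hp A h0.symm, Matrix.zero_mulVec]
  · rw [hcp]
    exact ⟨hmin (hmem k), hM ⟨_, hmem k, rfl⟩⟩

/-- The averages for a convergent normalization. -/
lemma isAverageLimit_of_tendsto (h : IsErgodic T v w) {l : ℝ} (hl : l ≠ 0)
    (hc : Tendsto c atTop (𝓝 l)) :
    IsAverageLimit T c (l⁻¹ • Matrix.vecMulVec v w) := by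
  obtain ⟨C, hC⟩ := h.bounded
  have h1 : Tendsto (fun k : ℕ => ((c (k + 1))⁻¹ - l⁻¹) • T ^ (k + 1)) atTop (𝓝 0) := by
    have h2 : Tendsto (fun k : ℕ => (c (k + 1))⁻¹ - l⁻¹) atTop (𝓝 0) := by
      have := ((hc.inv₀ hl).comp (tendsto_add_atTop_nat 1)).sub_const l⁻¹
      simpa using this
    refine squeeze_zero_norm (a := fun k : ℕ => ‖(c (k + 1))⁻¹ - l⁻¹‖ * C) (fun k => ?_) ?_
    · rw [norm_smul]
      gcongr
      exact hC _
    · simpa using h2.norm.mul_const C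
  -- The terms `(1 / c k - 1 / l) T ^ k` tend to zero, hence so do their Cesàro means; what remains
  -- is `1 / l` times the plain average.
  have h3 := h1.cesaro_smul.add (h.isAverageLimit_one.const_smul l⁻¹)
  rw [zero_add] at h3
  refine h3.congr fun N => ?_
  have h4 : ∑ k ∈ Finset.range N, ((c (k + 1))⁻¹ - l⁻¹) • T ^ (k + 1) =
      ∑ k ∈ Finset.Icc 1 N, ((c k)⁻¹ - l⁻¹) • T ^ k := by
    rw [Finset.range_eq_Ico, Finset.sum_Ico_add' (fun k => ((c k)⁻¹ - l⁻¹) • T ^ k) 0 N 1]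
    rfl
  rw [h4, smul_comm l⁻¹, ← smul_add, Finset.smul_sum, ← Finset.sum_add_distrib]
  congr 1
  refine Finset.sum_congr rfl fun k _ => ?_
  module

/-- Each average fixes `v` and `w` up to a common positive factor. -/
lemma exists_smul_of_isAverageLimit (h : IsErgodic T v w) {M : ℝ}
    (hc : ∀ k, 0 < c k ∧ c k ≤ M) {S : Matrix ι ι ℂ} (hS : IsAverageLimit T c S) :
    ∃ a : ℝ, 0 < a ∧ S *ᵥ v = (a : ℂ) • v ∧ w ᵥ* S = (a : ℂ) • w := by
  have hM : 0 < M := (hc 0).1.trans_le (hc 0).2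
  set m := fun N : ℕ => (N : ℝ)⁻¹ * ∑ k ∈ Finset.Icc 1 N, (c k)⁻¹ with hm
  set avg := fun N : ℕ => (N : ℝ)⁻¹ • ∑ k ∈ Finset.Icc 1 N, (c k)⁻¹ • T ^ k with havg
  have hv : ∀ N, avg N *ᵥ v = (m N : ℂ) • v := by
    intro N
    simp only [havg, hm, Matrix.smul_mulVec, Matrix.sum_mulVec, h.pow_mulVec, ← Finset.sum_smul,
      smul_smul]
    rw [Complex.coe_smul]
  have hw : ∀ N, w ᵥ* avg N = (m N : ℂ) • w := by
    intro N
    simp only [havg, hm, Matrix.vecMul_smul, Matrix.vecMul_sum, h.vecMul_pow, ← Finset.sum_smul,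
      smul_smul]
    rw [Complex.coe_smul]
  have hS' : Tendsto avg atTop (𝓝 S) := hS
  have hSv : Tendsto (fun N => avg N *ᵥ v) atTop (𝓝 (S *ᵥ v)) :=
    (Continuous.tendsto (by fun_prop : Continuous fun A : Matrix ι ι ℂ => A *ᵥ v) S).comp hS'
  have hwS : Tendsto (fun N => w ᵥ* avg N) atTop (𝓝 (w ᵥ* S)) :=
    (Continuous.tendsto (by fun_prop : Continuous fun A : Matrix ι ι ℂ => w ᵥ* A) S).comp hS'
  have hmC : Tendsto (fun N => (m N : ℂ)) atTop (𝓝 (w ⬝ᵥ S *ᵥ v)) := by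
    have h1 := (Continuous.tendsto (by fun_prop : Continuous fun u : ι → ℂ => w ⬝ᵥ u) _).comp hSv
    refine h1.congr fun N => ?_
    simp [hv, h.dotProduct_eq]
  set z := w ⬝ᵥ S *ᵥ v
  have hre : Tendsto m atTop (𝓝 z.re) := by
    exact (Complex.continuous_re.tendsto z).comp hmC
  have hz : ((z.re : ℝ) : ℂ) = z :=
    tendsto_nhds_unique ((Complex.continuous_ofReal.tendsto _).comp hre) hmC
  refine ⟨z.re, ?_, ?_, ?_⟩
  -- The bound `c k ≤ M` keeps the averages of `1 / c k` above `1 / M`, so the limiting scalar is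
  -- positive.
  · refine (inv_pos.mpr hM).trans_le (ge_of_tendsto hre ?_)
    filter_upwards [eventually_ge_atTop 1] with N hN
    have hN' : (0 : ℝ) < N := by exact_mod_cast hN
    have h1 : ∑ k ∈ Finset.Icc 1 N, M⁻¹ ≤ ∑ k ∈ Finset.Icc 1 N, (c k)⁻¹ :=
      Finset.sum_le_sum fun k _ => inv_anti₀ (hc k).1 (hc k).2
    rw [Finset.sum_const, Nat.card_Icc, Nat.add_sub_cancel, nsmul_eq_mul] at h1
    calc M⁻¹ = (N : ℝ)⁻¹ * (N * M⁻¹) := by field_simp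
      _ ≤ m N := by simp only [hm]; gcongr
  · rw [hz]
    refine tendsto_nhds_unique hSv ?_
    simp only [hv]
    exact hmC.smul_const v
  · rw [hz]
    refine tendsto_nhds_unique hwS ?_
    simp only [hw]
    exact hmC.smul_const w

end IsErgodic

end Normalizations

/-! ### Row and column conjugations -/

section Conjugations

variable {n d : ℕ} {X : Fin d → Matrix (Fin n) (Fin n) ℂ} {V W : Matrix (Fin n) (Fin n) ℂ}

lemma blockRow_mul_conjTranspose (Y : Fin d → Matrix (Fin n) (Fin n) ℂ) :
    blockRow Y * (blockRow Y)ᴴ = krausMap Y 1 := by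
  ext a b
  simp [blockRow, krausMap, Matrix.mul_apply, Matrix.sum_apply, Fintype.sum_prod_type]

lemma blockCol_conjTranspose_mul (Y : Fin d → Matrix (Fin n) (Fin n) ℂ) :
    (blockCol Y)ᴴ * blockCol Y = krausMap (fun i => (Y i)ᴴ) 1 := by
  ext a b
  simp [blockCol, krausMap, Matrix.mul_apply, Matrix.sum_apply, Fintype.sum_prod_type]

lemma krausMap_rowConj_one (hV : V.PosDef) (hφV : krausMap X V = V) :
    krausMap (rowConj V X) 1 = 1 := by
  have hS := hV.posDef_sqrt
  have hdet := (Matrix.isUnit_iff_isUnit_det _).mp hS.isUnit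
  have h1 : ((CFC.sqrt V)⁻¹)ᴴ = (CFC.sqrt V)⁻¹ := hS.inv.isHermitian
  have h2 : krausMap (rowConj V X) 1 = (CFC.sqrt V)⁻¹ * krausMap X V * (CFC.sqrt V)⁻¹ := by
    simp only [krausMap, rowConj, Finset.mul_sum, Finset.sum_mul, Matrix.conjTranspose_mul, h1,
      hS.isHermitian.eq, mul_one]
    refine Finset.sum_congr rfl fun i _ => ?_
    have e : ∀ A, CFC.sqrt V * (CFC.sqrt V * A) = V * A := fun A => by
      rw [← mul_assoc, hV.sqrt_mul_sqrt]
    simp only [mul_assoc, e]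
  rw [h2, hφV]
  nth_rw 2 [← hV.sqrt_mul_sqrt]
  rw [← mul_assoc, Matrix.nonsing_inv_mul _ hdet, one_mul, Matrix.mul_nonsing_inv _ hdet]

/-- Taking adjoints turns the column statement for `W` into the row statement for the tuple `Xᵢ*`.
-/
lemma conjTranspose_colConj (hW : W.PosDef) :
    (fun i => (colConj W X i)ᴴ) = rowConj W fun i => (X i)ᴴ := by
  have h1 : ((CFC.sqrt W)⁻¹)ᴴ = (CFC.sqrt W)⁻¹ := hW.posDef_sqrt.inv.isHermitian
  funext i
  simp only [colConj, rowConj, Matrix.conjTranspose_mul, h1, hW.posDef_sqrt.isHermitian.eq,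
    mul_assoc]

lemma isTracePreserving_krausMap {Y : Fin d → Matrix (Fin n) (Fin n) ℂ}
    (hY : krausMap (fun i => (Y i)ᴴ) 1 = 1) : IsTracePreserving (krausMap Y) := by
  intro H
  have := trace_mul_krausMap (X := Y) 1 H
  rwa [hY, one_mul, one_mul] at this

end Conjugations

/-! ### Rank one limits -/

lemma vecOuter_mulVec_vec {n : ℕ} (V W H : Matrix (Fin n) (Fin n) ℂ) :
    vecOuter V W *ᵥ H.vec = ((Wᴴ * H).trace • V).vec := by
  rw [vecOuter, Matrix.vecMulVec_mulVec, Matrix.star_vec_dotProduct_vec, op_smul_eq_smul,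
    Matrix.vec_smul]

lemma star_vec_vecMul_vecOuter {n : ℕ} (V W H : Matrix (Fin n) (Fin n) ℂ) :
    star H.vec ᵥ* vecOuter V W = (Hᴴ * V).trace • star W.vec := by
  rw [vecOuter, Matrix.vecMul_vecMulVec, Matrix.star_vec_dotProduct_vec]

/-- Rank one matrices that act on `vec V` and `(vec W)*` as a positive scalar. -/
lemma exists_scalars_of_vecOuter {n : ℕ} {V W V' W' : Matrix (Fin n) (Fin n) ℂ}
    (hW : W.PosDef) (htr : (W * V).trace = 1) {a : ℝ}
    (ha : 0 < a) (hv : vecOuter V' W' *ᵥ V.vec = (a : ℂ) • V.vec)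
    (hw : star W.vec ᵥ* vecOuter V' W' = (a : ℂ) • star W.vec) :
    ∃ α : ℂ, α ≠ 0 ∧ V' = (a / α) • V ∧ W' = star α • W := by
  rw [vecOuter_mulVec_vec, ← Matrix.vec_smul, Matrix.vec_inj] at hv
  rw [star_vec_vecMul_vecOuter, hW.isHermitian.eq] at hw
  set α := (W'ᴴ * V).trace with hα
  set β := (W * V').trace with hβ
  have ha' : (a : ℂ) ≠ 0 := by exact_mod_cast ha.ne'
  -- Pair `α V' = a V` with `W`, using `tr(WV) = 1`.
  have hαβ : α * β = a := by
    have h1 := congrArg (fun A => (W * A).trace) hv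
    simpa [Matrix.mul_smul, Matrix.trace_smul, htr] using h1
  have hα0 : α ≠ 0 := by
    intro h0
    rw [h0, zero_mul] at hαβ
    exact ha' hαβ.symm
  have hβ0 : β ≠ 0 := by
    intro h0
    rw [h0, mul_zero] at hαβ
    exact ha' hαβ.symm
  refine ⟨α, hα0, ?_, ?_⟩
  · rw [div_eq_inv_mul, mul_smul, ← hv, smul_smul, inv_mul_cancel₀ hα0, one_smul]
  · have h1 : β • star W'.vec = β • (α • star W.vec) := by
      rw [hw, smul_smul, mul_comm β α, hαβ]
    have h2 := congrArg star (smul_right_injective _ hβ0 h1)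
    rw [star_star, star_smul, star_star, ← Matrix.vec_smul, Matrix.vec_inj] at h2
    exact h2

end OuterSpectrum

/-! ### The main theorem -/

open OuterSpectrum in
theorem mainTheorem9 {n d : ℕ} (X : Fin d → Matrix (Fin n) (Fin n) ℂ)
    (hρ : OuterSpectrum.outerSpectralRadius X = 1)
    (hgen : Algebra.adjoin ℂ (Set.range X) = ⊤) :
    -- the average of the iterates exists and has the form `vec V (vec W)*` with positive `V`, `W`
    (∃ V W : Matrix (Fin n) (Fin n) ℂ, V.PosDef ∧ W.PosDef ∧
      OuterSpectrum.IsAverageLimit (OuterSpectrum.transferMatrix X)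
        (OuterSpectrum.growth (OuterSpectrum.transferMatrix X))
        (OuterSpectrum.vecOuter V W)) ∧
    -- the same with the normalization by a norm, if `‖T ^ k‖` does not oscillate
    (∀ c : ℕ → ℝ, OuterSpectrum.IsNormGrowth (OuterSpectrum.transferMatrix X) c →
      ((∀ μ ∈ spectrum ℂ (OuterSpectrum.transferMatrix X), ‖μ‖ = 1 → μ = 1) ∨
        ∃ l : ℝ, Tendsto c atTop (𝓝 l)) →
      ∃ V W : Matrix (Fin n) (Fin n) ℂ, V.PosDef ∧ W.PosDef ∧
        OuterSpectrum.IsAverageLimit (OuterSpectrum.transferMatrix X) c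
          (OuterSpectrum.vecOuter V W)) ∧
    -- with either normalization, each such form of the average yields the two conjugations
    (∀ c : ℕ → ℝ,
      (c = OuterSpectrum.growth (OuterSpectrum.transferMatrix X) ∨
        OuterSpectrum.IsNormGrowth (OuterSpectrum.transferMatrix X) c) →
      ∀ V W : Matrix (Fin n) (Fin n) ℂ,
        OuterSpectrum.IsAverageLimit (OuterSpectrum.transferMatrix X) c
          (OuterSpectrum.vecOuter V W) →
        (∃ z : ℂ, ‖z‖ = 1 ∧ (z • V).PosDef ∧ (z • W).PosDef) ∧
        (V.PosDef → W.PosDef →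
          OuterSpectrum.IsRowCoisometry (OuterSpectrum.rowConj V X) ∧
          OuterSpectrum.IsColumnIsometry (OuterSpectrum.colConj W X) ∧
          OuterSpectrum.IsUnital (OuterSpectrum.krausMap (OuterSpectrum.rowConj V X)) ∧
          OuterSpectrum.IsTracePreserving
            (OuterSpectrum.krausMap (OuterSpectrum.colConj W X)))) := by
  obtain ⟨hsr, V, W, hV, hW, hφV, hφW, htr⟩ := exists_fixed_points hρ hgen
  have herg := isErgodic_transferMatrix hgen hV hW hφV hφW htr
  -- Bounded powers give `η ≤ 1`, so the exponent `η - 1` is zero.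
  have hgrowth : growth (transferMatrix X) = fun _ => 1 := by
    funext k
    rw [growth, Nat.sub_eq_zero_of_le (maxDegeneracyIndex_le_one herg.bounded hsr), pow_zero]
  refine ⟨⟨V, W, hV, hW, ?_⟩, ?_, ?_⟩
  · rw [hgrowth]
    exact herg.isAverageLimit_one
  · intro c hc hosc
    obtain ⟨δ, M, hδ, hbd⟩ := herg.exists_bounds_of_isNormGrowth hc
    have hconv : ∃ l : ℝ, Tendsto c atTop (𝓝 l) := by
      rcases hosc with hμ | hl
      · obtain ⟨p, -, hcp⟩ := hc
        refine ⟨p (Matrix.vecMulVec V.vec (star W.vec)), ?_⟩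
        exact (((continuous_seminorm_matrix p).tendsto _).comp (herg.tendsto_pow hμ)).congr
          fun k => (hcp k).symm
      · exact hl
    obtain ⟨l, hl⟩ := hconv
    have hl0 : 0 < l := hδ.trans_le (ge_of_tendsto' hl fun k => (hbd k).1)
    refine ⟨l⁻¹ • V, W, hV.smul (by positivity), hW, ?_⟩
    have h1 := herg.isAverageLimit_of_tendsto hl0.ne' hl
    rwa [← Matrix.smul_vecMulVec, ← Matrix.vec_smul] at h1
  · intro c hc V' W' hlim
    have hbd : ∃ M : ℝ, ∀ k, 0 < c k ∧ c k ≤ M := by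
      rcases hc with rfl | hc
      · exact ⟨1, fun k => by simp [hgrowth]⟩
      · obtain ⟨δ, M, hδ, hbd⟩ := herg.exists_bounds_of_isNormGrowth hc
        exact ⟨M, fun k => ⟨hδ.trans_le (hbd k).1, (hbd k).2⟩⟩
    obtain ⟨M, hM⟩ := hbd
    obtain ⟨a, ha, hv, hw⟩ := herg.exists_smul_of_isAverageLimit hM hlim
    obtain ⟨α, hα, hV', hW'⟩ := exists_scalars_of_vecOuter hW htr ha hv hw
    have hα' : 0 < ‖α‖ := norm_pos_iff.mpr hα
    have hαc : (‖α‖ : ℂ) ≠ 0 := by exact_mod_cast hα'.ne'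
    -- With `V' = (a / α) V` and `W' = conj(α) W`, the phase of `α` makes both scalars positive.
    refine ⟨⟨α / ‖α‖, by simp [hα'.ne'], ?_, ?_⟩, fun hVp hWp => ?_⟩
    · have h1 : (α / ‖α‖) • V' = (a / ‖α‖ : ℝ) • V := by
        rw [hV', smul_smul, ← Complex.coe_smul (a / ‖α‖) V]
        congr 1
        push_cast
        field_simp
      rw [h1]
      exact hV.smul (by positivity)
    · have h1 : (α / ‖α‖) • W' = (‖α‖ : ℝ) • W := by
        rw [hW', smul_smul, ← Complex.coe_smul ‖α‖ W]
        congr 1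
        rw [div_mul_eq_mul_div, Complex.star_def, Complex.mul_conj']
        field_simp
      rw [h1]
      exact hW.smul hα'
    · have hfV : krausMap X V' = V' := by rw [hV', krausMap_smul, hφV]
      have hfW : krausMap (fun i => (X i)ᴴ) W' = W' := by rw [hW', krausMap_smul, hφW]
      have h1 := krausMap_rowConj_one hVp hfV
      have h2 : krausMap (fun i => (colConj W' X i)ᴴ) 1 = 1 := by
        rw [conjTranspose_colConj hWp]
        exact krausMap_rowConj_one hWp hfW
      exact ⟨by rw [IsRowCoisometry, blockRow_mul_conjTranspose, h1],
        by rw [IsColumnIsometry, blockCol_conjTranspose_mul, h2], h1,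
        isTracePreserving_krausMap h2⟩
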